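/- All digraphs are finite and simple (no loops, no multiple arcs). For a strongly connected digraph $G$ with vertices $v_1,\dots,v_n$ let $d(v_i,v_j)$ be the length of a shortest directed path from $v_i$ to $v_j$, let $D(G)=(d(v_i,v_j))_{i,j}$, let $\mathrm{Diag}(Tr)$ be the diagonal matrix with entries $\sum_j d(v_i,v_j)$, and for $0\le\alpha<1$ let $D_\alpha(G)=\alpha\,\mathrm{Diag}(Tr)+(1-\alpha)D(G)$. Let $\mu_\alpha(G)$ be the spectral radius of $D_\alpha(G)$, that is, the largest modulus of its complex eigenvalues. The vertex connectivity of $G$ is the minimum number of vertices whose removal leaves a digraph that is not strongly connected or has at most one vertex. For $1\le m\le n-k-1$ let $K(n,k,m)$ be the digraph on the disjoint union of vertex sets $A,B,C$ with $|A|=k$, $|B|=n-k-m$, $|C|=m$, whose arcs are all ordered pairs of distinct vertices except those from $B$ to $C$. **Theorem 4.6.** Let $n,k$ be positive integers with $n\ge 2k+2$, and let $G$ be a strongly connected digraph of order $n$ with vertex connectivity $k$. (i) For $\alpha=0$, $$\mu_0(G)\ \ge\ \frac{n-2+\sqrt{n^2+4n-4k-4}}{2},$$ with equality if and only if $G\cong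 K(n,k,n-k-1)$ or $G\cong K(n,k,1)$. Moreover, $\mu_0(K(n,k,1))$ and $\mu_0(K(n,k,n-k-1))$ are both equal to the right-hand side. (ii) For every $0<\alpha<1$, $$\mu_\alpha(G)\ \ge\ \frac{n-2+\alpha+\alpha n+\sqrt{(1-\alpha)^2n^2+(2\alpha^2-6\alpha+4)n+(\alpha^2+4\alpha-4)-4(1-\alpha)k}}{2},$$ with equality if and only if $G\cong K(n,k,1)$. Moreover, the right-hand side is equal to $\mu_\alpha(K(n,k,1))$; that is, $\mu_\alpha(G)\ge\mu_\alpha(K(n,k,1))$. -/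

import Mathlib

namespace Digraph

universe u v

/-- `G.HasWalk l a b`: there is a directed walk with exactly `l` arcs from `a` to `b` in `G`.
(A shortest walk never repeats a vertex, so walks and paths give the same reachability relation
and the same distance.) -/
inductive HasWalk {V : Type u} (G : Digraph V) : ℕ → V → V → Prop
  | nil (a : V) : HasWalk G 0 a a
  | cons {l : ℕ} {a b c : V} : G.Adj a b → HasWalk G l b c → HasWalk G (l + 1) a c

/-- Every vertex can be reached from every vertex along a directed walk. -/
def StronglyConnected {V : Type u} (G : Digraph V) : Prop :=
  ∀ a b : V, ∃ l : ℕ, G.HasWalk l a b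

/-- The length of a shortest directed path from `a` to `b` (junk value `0` if there is none, which
does not happen in a strongly connected digraph). -/
noncomputable def dist {V : Type u} (G : Digraph V) (a b : V) : ℕ :=
  sInf {l : ℕ | G.HasWalk l a b}

/-- The transmission of `a`: the sum of the distances from `a` to all vertices. -/
noncomputable def transmission {V : Type u} [Fintype V] (G : Digraph V) (a : V) : ℕ :=
  ∑ b, G.dist a b

/-- The distance matrix. -/
noncomputable def distMatrix {V : Type u} (G : Digraph V) : Matrix V V ℝ :=
  Matrix.of fun a b => (G.dist a b : ℝ)

/-- The generalized distance matrix `D_α(G) = α Diag(Tr) + (1 - α) D(G)`. -/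
noncomputable def genDistMatrix {V : Type u} [Fintype V] [DecidableEq V]
    (α : ℝ) (G : Digraph V) : Matrix V V ℝ :=
  α • Matrix.diagonal (fun a => (G.transmission a : ℝ)) + (1 - α) • G.distMatrix

/-- The `D_α` spectral radius `μ_α(G)`: the largest modulus of a complex eigenvalue of `D_α(G)`. -/
noncomputable def mu {V : Type u} [Fintype V] [DecidableEq V] (α : ℝ) (G : Digraph V) : ℝ :=
  (spectralRadius ℂ ((genDistMatrix α G).map Complex.ofReal)).toReal

/-- The subdigraph induced on a set of vertices. -/
def inducedOn {V : Type u} (G : Digraph V) (S : Set V) : Digraph S where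
  Adj a b := G.Adj a b

/-- The vertex connectivity: the least number of vertices whose removal leaves a digraph that is
not strongly connected or has at most one vertex. The second alternative only matters for complete
digraphs, to which it gives the usual value (order minus one). -/
noncomputable def vertexConnectivity {V : Type u} [Fintype V] [DecidableEq V]
    (G : Digraph V) : ℕ :=
  sInf {c : ℕ | ∃ S : Finset V, S.card = c ∧
    (¬ (G.inducedOn {a | a ∉ S}).StronglyConnected ∨ Sᶜ.card ≤ 1)}

/-- The complete digraph without loops. -/
def looplessComplete (V : Type u) : Digraph V where
  Adj a b := a ≠ b

/-- The disjoint union `G ∪ H`. -/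
def disjUnion {V : Type u} {W : Type v} (G : Digraph V) (H : Digraph W) : Digraph (V ⊕ W) where
  Adj
    | .inl a, .inl b => G.Adj a b
    | .inr a, .inr b => H.Adj a b
    | .inl _, .inr _ => False
    | .inr _, .inl _ => False

/-- The join `G ∨ H`: the disjoint union with all arcs, in both directions, between the parts. -/
def join {V : Type u} {W : Type v} (G : Digraph V) (H : Digraph W) : Digraph (V ⊕ W) where
  Adj
    | .inl a, .inl b => G.Adj a b
    | .inr a, .inr b => H.Adj a b
    | .inl _, .inr _ => True
    | .inr _, .inl _ => True

/-- Vertices of `K(n, k, m)`: those of `K_k`, of `K_{n-k-m}`, and of `K_m`, in this order. -/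
abbrev KVertex (n k m : ℕ) : Type := Fin k ⊕ (Fin (n - k - m) ⊕ Fin m)

/-- `K(n, k, m) = K_k ∨ (K_{n-k-m} ∪ K_m) + E`, where `E` consists of all arcs from `K_m` to
`K_{n-k-m}` (for `1 ≤ m ≤ n - k - 1`). -/
def K (n k m : ℕ) : Digraph (KVertex n k m) where
  Adj x y :=
    (join (looplessComplete (Fin k))
      (disjUnion (looplessComplete (Fin (n - k - m))) (looplessComplete (Fin m)))).Adj x y ∨
    ∃ (a : Fin m) (b : Fin (n - k - m)), x = .inr (.inr a) ∧ y = .inr (.inl b)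

/-- Isomorphism of digraphs. -/
def Isomorphic {V : Type u} {W : Type v} (G : Digraph V) (H : Digraph W) : Prop :=
  Nonempty (G.Adj ≃r H.Adj)

end Digraph

/-! A separating set of `k` vertices leaves nonempty `B`, `C` with no arcs from `B` to `C` and `|B|
+ |C| = n - k`. So distinct vertices are at distance at least 1, and at least 2 from `B` to `C`;
these minima are `cutDist`.

All sizes of `B` and `C` are compared with one target `r = muMin n k α`. A positive vector `x`,
constant on `B` and off `B`, is chosen so that the `D_α` matrix built from `cutDist` sends `x` to `r
x` plus a `gap ≥ 0` on `B`. Rows of `D_α(G) x` are monotone in the distances, so `r x ≤ D_α(G) x`,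
and Collatz–Wielandt gives `r ≤ μ_α(G)`.

Off-diagonal entries are positive, so equality forces every row to be tight. Then all distances are
minimal, which determines the arcs of `G`, and `gap = 0`, which means `|C| = 1`, or `α = 0` and `|B|
= 1`. Conversely, `x` is then a positive eigenvector for `r`. -/

/-! ### Collatz–Wielandt bounds for nonnegative matrices. -/

open Filter Topology in
/-- A nonnegative matrix with `r x ≤ M x` for a positive vector `x` has spectral radius at least
`r`. -/
theorem le_spectralRadius_of_smul_le_mulVec {V : Type*} [Fintype V] [DecidableEq V] [Nonempty V]
    (M : Matrix V V ℝ) (hM : ∀ i j, 0 ≤ M i j) (x : V → ℝ) (hx : ∀ i, 0 < x i) (r : ℝ)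
    (hr : 0 ≤ r) (h : ∀ i, r * x i ≤ M.mulVec x i) :
    r ≤ (spectralRadius ℂ (M.map Complex.ofReal)).toReal := by
  let _ : NormedRing (Matrix V V ℂ) := Matrix.linftyOpNormedRing
  let _ : NormedAlgebra ℂ (Matrix V V ℂ) := Matrix.linftyOpNormedAlgebra
  have : CompleteSpace (Matrix V V ℂ) := FiniteDimensional.complete ℂ _
  set A : Matrix V V ℂ := M.map Complex.ofReal with hA
  have hmono : ∀ l : ℕ, ∀ i, r ^ l * x i ≤ (M ^ l).mulVec x i := by
    intro l
    induction l with
    | zero => simp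
    | succ l ih =>
      intro i
      rw [pow_succ' M, ← Matrix.mulVec_mulVec]
      calc r ^ (l + 1) * x i = r ^ l * (r * x i) := by ring
        _ ≤ r ^ l * M.mulVec x i := mul_le_mul_of_nonneg_left (h i) (pow_nonneg hr l)
        _ = ∑ j, M i j * (r ^ l * x j) := by
          simp only [Matrix.mulVec, dotProduct, Finset.mul_sum]
          exact Finset.sum_congr rfl fun j _ => by ring
        _ ≤ ∑ j, M i j * (M ^ l).mulVec x j :=
          Finset.sum_le_sum fun j _ => mul_le_mul_of_nonneg_left (ih j) (hM i j)
  have hpow : ∀ l : ℕ, A ^ l = (M ^ l).map Complex.ofReal := fun l =>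
    (Matrix.map_pow M Complex.ofRealHom l).symm
  obtain ⟨i₀⟩ := ‹Nonempty V›
  set z : V → ℂ := fun i => (x i : ℂ) with hz
  have hvec : ∀ l : ℕ, (A ^ l).mulVec z = fun i => (((M ^ l).mulVec x i : ℝ) : ℂ) := by
    intro l
    ext i
    rw [hpow]
    simp [Matrix.mulVec, dotProduct, hz]
  obtain ⟨i₁, -, hi₁⟩ := Finset.exists_max_image Finset.univ x ⟨i₀, Finset.mem_univ _⟩
  have hznorm : ‖z‖ = x i₁ := by
    apply le_antisymm
    · refine (pi_norm_le_iff_of_nonneg (hx i₁).le).2 fun i => ?_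
      simpa [hz, abs_of_pos (hx i)] using hi₁ i (Finset.mem_univ _)
    · have := norm_le_pi_norm z i₁
      simpa [hz, abs_of_pos (hx i₁)] using this
  -- Reading `r ^ l x ≤ M ^ l x` at the largest coordinate of `x` bounds the sup operator norm;
  -- Gelfand's formula then gives the spectral radius.
  have hnorm : ∀ l : ℕ, r ^ l ≤ ‖A ^ l‖ := by
    intro l
    have h1 : ‖(A ^ l).mulVec z‖ ≤ ‖A ^ l‖ * ‖z‖ := Matrix.linfty_opNorm_mulVec _ _
    have h2 : r ^ l * x i₁ ≤ ‖(A ^ l).mulVec z‖ := by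
      refine le_trans ?_ (norm_le_pi_norm _ i₁)
      rw [hvec, Complex.norm_real]
      exact (hmono l i₁).trans (le_abs_self _)
    rw [hznorm] at h1
    exact le_of_mul_le_mul_right (h2.trans h1) (hx i₁)
  have hlim := spectrum.pow_norm_pow_one_div_tendsto_nhds_spectralRadius A
  have hle : ENNReal.ofReal r ≤ spectralRadius ℂ A := by
    refine ge_of_tendsto hlim ?_
    filter_upwards [eventually_ge_atTop 1] with l hl
    refine ENNReal.ofReal_le_ofReal ?_
    calc r = (r ^ l) ^ (1 / l : ℝ) := by
          rw [one_div, Real.pow_rpow_inv_natCast hr (by omega)]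
      _ ≤ _ := Real.rpow_le_rpow (pow_nonneg hr l) (hnorm l) (by positivity)
  have hfin : spectralRadius ℂ A ≠ ⊤ :=
    ne_top_of_le_ne_top ENNReal.coe_ne_top (spectrum.spectralRadius_le_nnnorm A)
  exact (ENNReal.ofReal_le_iff_le_toReal hfin).1 hle

/-- Strict version of `le_spectralRadius_of_smul_le_mulVec` for matrices whose off-diagonal entries
are positive. -/
theorem lt_spectralRadius_of_smul_lt_mulVec {V : Type*} [Fintype V] [DecidableEq V]
    (M : Matrix V V ℝ) (hM : ∀ i j, 0 ≤ M i j) (hM' : ∀ i j, i ≠ j → 0 < M i j)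
    (x : V → ℝ) (hx : ∀ i, 0 < x i) (r : ℝ)
    (hr : 0 ≤ r) (h : ∀ i, r * x i ≤ M.mulVec x i) (i₀ : V) (h₀ : r * x i₀ < M.mulVec x i₀) :
    r < (spectralRadius ℂ (M.map Complex.ofReal)).toReal := by
  have : Nonempty V := ⟨i₀⟩
  have hMx : ∀ i, 0 ≤ M.mulVec x i := fun i => (mul_nonneg hr (hx i).le).trans (h i)
  -- Replace `x` by `(M + 1) x`: the slack at `i₀` spreads to every row through the positive
  -- off-diagonal entries, so the least row ratio exceeds `r`.
  have hy : ∀ i, 0 < M.mulVec x i + x i := fun i => add_pos_of_nonneg_of_pos (hMx i) (hx i)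
  have hstrict : ∀ i, r * (M.mulVec x i + x i) < M.mulVec (fun j => M.mulVec x j + x j) i := by
    intro i
    have e : M.mulVec (fun j => M.mulVec x j + x j) i - r * (M.mulVec x i + x i)
        = ∑ j, M i j * (M.mulVec x j - r * x j) + (M.mulVec x i - r * x i) := by
      have e2 : r * M.mulVec x i = ∑ j, M i j * (r * x j) := by
        rw [Matrix.mulVec, dotProduct, Finset.mul_sum]
        exact Finset.sum_congr rfl fun j _ => by ring
      have e3 : M.mulVec (fun j => M.mulVec x j + x j) i
          = ∑ j, M i j * M.mulVec x j + M.mulVec x i := by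
        simp only [Matrix.mulVec, dotProduct, mul_add, Finset.sum_add_distrib]
      rw [e3, mul_add, e2]
      simp only [mul_sub, Finset.sum_sub_distrib]
      ring
    have hnn : ∀ j ∈ Finset.univ, 0 ≤ M i j * (M.mulVec x j - r * x j) := fun j _ =>
      mul_nonneg (hM i j) (sub_nonneg.2 (h j))
    have : 0 < ∑ j, M i j * (M.mulVec x j - r * x j) + (M.mulVec x i - r * x i) := by
      by_cases hi : i = i₀
      · subst hi
        exact add_pos_of_nonneg_of_pos (Finset.sum_nonneg hnn) (sub_pos.2 h₀)
      · refine add_pos_of_pos_of_nonneg ?_ (sub_nonneg.2 (h i))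
        exact Finset.sum_pos' hnn
          ⟨i₀, Finset.mem_univ _, mul_pos (hM' i i₀ hi) (sub_pos.2 h₀)⟩
    linarith
  obtain ⟨i₁, -, hi₁⟩ := Finset.exists_min_image Finset.univ
    (fun i => M.mulVec (fun j => M.mulVec x j + x j) i / (M.mulVec x i + x i))
    ⟨i₀, Finset.mem_univ _⟩
  have hlt := (lt_div_iff₀ (hy i₁)).2 (hstrict i₁)
  refine hlt.trans_le (le_spectralRadius_of_smul_le_mulVec M hM
    (fun j => M.mulVec x j + x j) hy _ (hr.trans hlt.le) fun i => ?_)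
  exact (le_div_iff₀ (hy i)).1 (hi₁ i (Finset.mem_univ _))

/-- A nonnegative matrix with a positive eigenvector has the eigenvalue as spectral radius. -/
theorem spectralRadius_eq_of_mulVec_eq {V : Type*} [Fintype V] [DecidableEq V] [Nonempty V]
    (M : Matrix V V ℝ) (hM : ∀ i j, 0 ≤ M i j) (x : V → ℝ) (hx : ∀ i, 0 < x i) (r : ℝ)
    (hr : 0 ≤ r) (h : ∀ i, M.mulVec x i = r * x i) :
    (spectralRadius ℂ (M.map Complex.ofReal)).toReal = r := by
  refine le_antisymm ?_ (le_spectralRadius_of_smul_le_mulVec M hM x hx r hr fun i => (h i).ge)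
  refine ENNReal.toReal_le_of_le_ofReal hr ?_
  refine iSup₂_le fun c hc => ?_
  rw [← enorm_eq_nnnorm, ← ofReal_norm]
  refine ENNReal.ofReal_le_ofReal ?_
  rw [← Matrix.spectrum_toLin', ← Module.End.hasEigenvalue_iff_mem_spectrum] at hc
  obtain ⟨v, hv⟩ := hc.exists_hasEigenvector
  have hv1 := hv.apply_eq_smul
  have hv0 := hv.2
  -- Where `‖v i‖ / x i` is largest, row `i` of the eigenvalue equation alone gives `‖c‖ ≤ r`.
  obtain ⟨i, -, hi⟩ := Finset.exists_max_image Finset.univ (fun i => ‖v i‖ / x i)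
    Finset.univ_nonempty
  have hb : ∀ j, ‖v j‖ ≤ ‖v i‖ / x i * x j := fun j =>
    (div_le_iff₀ (hx j)).1 (hi j (Finset.mem_univ _))
  have hpos : 0 < ‖v i‖ := by
    by_contra hcon
    have h0 : ‖v i‖ = 0 := le_antisymm (not_lt.1 hcon) (norm_nonneg _)
    apply hv0
    ext j
    have := hb j
    rw [h0] at this
    simpa using this
  have e1 : c * v i = ∑ j, (M i j : ℂ) * v j := by
    have := congrFun hv1 i
    simpa [Matrix.toLin'_apply, Matrix.mulVec, dotProduct] using this.symm
  have e2 : ‖c‖ * ‖v i‖ ≤ r * ‖v i‖ := by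
    rw [← norm_mul, e1]
    calc ‖∑ j, (M i j : ℂ) * v j‖ ≤ ∑ j, ‖(M i j : ℂ) * v j‖ := norm_sum_le _ _
      _ ≤ ∑ j, ‖v i‖ / x i * (M i j * x j) := by
        refine Finset.sum_le_sum fun j _ => ?_
        rw [norm_mul, Complex.norm_real, Real.norm_of_nonneg (hM i j)]
        calc M i j * ‖v j‖ ≤ M i j * (‖v i‖ / x i * x j) :=
              mul_le_mul_of_nonneg_left (hb j) (hM i j)
          _ = _ := by ring
      _ = ‖v i‖ / x i * M.mulVec x i := by
        rw [← Finset.mul_sum]; rfl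
      _ = r * ‖v i‖ := by
        rw [h i]
        field_simp [(hx i).ne']
  exact le_of_mul_le_mul_right e2 hpos

/-! ### Distances across a one-way cut. -/

namespace Digraph
variable {V : Type*}

theorem StronglyConnected.hasWalk_dist {G : Digraph V} (hG : G.StronglyConnected) (a b : V) :
    G.HasWalk (G.dist a b) a b :=
  Nat.sInf_mem (s := {l : ℕ | G.HasWalk l a b}) (hG a b)

theorem dist_le_of_hasWalk {G : Digraph V} {a b : V} {l : ℕ} (h : G.HasWalk l a b) :
    G.dist a b ≤ l :=
  Nat.sInf_le h

theorem dist_self (G : Digraph V) (a : V) : G.dist a a = 0 :=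
  Nat.le_zero.1 (dist_le_of_hasWalk (.nil a))

theorem hasWalk_zero_iff {G : Digraph V} {a b : V} : G.HasWalk 0 a b ↔ a = b := by
  constructor
  · intro h; cases h; rfl
  · rintro rfl; exact .nil a

theorem hasWalk_one_iff {G : Digraph V} {a b : V} : G.HasWalk 1 a b ↔ G.Adj a b := by
  constructor
  · intro h
    cases h with
    | cons h1 h2 => rwa [← hasWalk_zero_iff.1 h2]
  · intro h; exact .cons h (.nil b)

theorem StronglyConnected.one_le_dist {G : Digraph V} (hG : G.StronglyConnected) {a b : V}
    (hab : a ≠ b) : 1 ≤ G.dist a b := by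
  by_contra hcon
  have h0 : G.dist a b = 0 := by omega
  have := hG.hasWalk_dist a b
  rw [h0] at this
  exact hab (hasWalk_zero_iff.1 this)

theorem StronglyConnected.two_le_dist {G : Digraph V} (hG : G.StronglyConnected) {a b : V}
    (hab : a ≠ b) (h : ¬ G.Adj a b) : 2 ≤ G.dist a b := by
  by_contra hcon
  have h1 := hG.one_le_dist hab
  have h0 : G.dist a b = 1 := by omega
  have := hG.hasWalk_dist a b
  rw [h0] at this
  exact h (hasWalk_one_iff.1 this)

/-- The arcs of `G` are all ordered pairs of distinct vertices except those from `B` to `C`. -/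
def CompleteExcept (G : Digraph V) (B C : Finset V) : Prop :=
  ∀ a b : V, G.Adj a b ↔ a ≠ b ∧ ¬ (a ∈ B ∧ b ∈ C)

/-- The least distances that the absence of arcs from `B` to `C` permits. -/
def cutDist [DecidableEq V] (B C : Finset V) (a b : V) : ℕ :=
  (if a = b then 0 else 1) + if a ∈ B ∧ b ∈ C then 1 else 0

theorem StronglyConnected.cutDist_le_dist [DecidableEq V] {G : Digraph V}
    (hG : G.StronglyConnected)
    {B C : Finset V} (hBC : Disjoint B C) (hno : ∀ a ∈ B, ∀ b ∈ C, ¬ G.Adj a b) (a b : V) :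
    cutDist B C a b ≤ G.dist a b := by
  unfold cutDist
  by_cases hab : a = b
  · subst hab
    have : ¬ (a ∈ B ∧ a ∈ C) := fun h => Finset.disjoint_left.1 hBC h.1 h.2
    simp [this]
  · by_cases h : a ∈ B ∧ b ∈ C
    · simpa [hab, h] using hG.two_le_dist hab (hno a h.1 b h.2)
    · simpa [hab, h] using hG.one_le_dist hab

theorem StronglyConnected.completeExcept_of_dist_eq [DecidableEq V] {G : Digraph V}
    (hG : G.StronglyConnected) (hloopless : ∀ a : V, ¬ G.Adj a a)
    {B C : Finset V} (hno : ∀ a ∈ B, ∀ b ∈ C, ¬ G.Adj a b)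
    (hdist : ∀ a b, G.dist a b = cutDist B C a b) : G.CompleteExcept B C := by
  intro a b
  constructor
  · intro h
    refine ⟨?_, fun h' => hno a h'.1 b h'.2 h⟩
    rintro rfl
    exact hloopless a h
  · rintro ⟨hab, h⟩
    by_contra hcon
    have := hG.two_le_dist hab hcon
    rw [hdist] at this
    simp [cutDist, hab, h] at this

theorem CompleteExcept.hasWalk_cutDist [DecidableEq V] {G : Digraph V} {B C : Finset V}
    (h : G.CompleteExcept B C) (hBC : Disjoint B C) (hA : ∃ v, v ∉ B ∧ v ∉ C) (a b : V) :
    G.HasWalk (cutDist B C a b) a b := by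
  obtain ⟨v, hvB, hvC⟩ := hA
  by_cases hab : a = b
  · subst hab
    have : ¬ (a ∈ B ∧ a ∈ C) := fun h => Finset.disjoint_left.1 hBC h.1 h.2
    simpa [cutDist, this] using HasWalk.nil a
  · by_cases hm : a ∈ B ∧ b ∈ C
    -- A vertex outside `B` and `C` serves as the midpoint of a walk of length 2.
    · have h1 : G.Adj a v := (h a v).2 ⟨by rintro rfl; exact hvB hm.1, fun h => hvC h.2⟩
      have h2 : G.Adj v b := (h v b).2 ⟨by rintro rfl; exact hvC hm.2, fun h => hvB h.1⟩
      simpa [cutDist, hab, hm] using HasWalk.cons h1 (hasWalk_one_iff.2 h2)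
    · simpa [cutDist, hab, hm, hasWalk_one_iff] using (h a b).2 ⟨hab, hm⟩

theorem CompleteExcept.stronglyConnected {G : Digraph V} {B C : Finset V}
    (h : G.CompleteExcept B C) (hBC : Disjoint B C) (hA : ∃ v, v ∉ B ∧ v ∉ C) :
    G.StronglyConnected := by
  classical
  exact fun a b => ⟨_, h.hasWalk_cutDist hBC hA a b⟩

theorem CompleteExcept.dist_eq [DecidableEq V] {G : Digraph V} {B C : Finset V}
    (h : G.CompleteExcept B C) (hBC : Disjoint B C) (hA : ∃ v, v ∉ B ∧ v ∉ C) (a b : V) :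
    G.dist a b = cutDist B C a b :=
  le_antisymm (dist_le_of_hasWalk (h.hasWalk_cutDist hBC hA a b))
    ((h.stronglyConnected hBC hA).cutDist_le_dist hBC
      (fun a ha b hb hadj => ((h a b).1 hadj).2 ⟨ha, hb⟩) a b)

theorem HasWalk.concat {G : Digraph V} {l : ℕ} {a b c : V} (h : G.HasWalk l a b)
    (hbc : G.Adj b c) : G.HasWalk (l + 1) a c := by
  induction h with
  | nil a => exact .cons hbc (.nil c)
  | cons h1 _ ih => exact .cons h1 (ih hbc)

/-! ### Vertex cuts and the digraphs `K(n, k, m)`. -/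

/-- A digraph whose vertex connectivity is less than its order minus one has a minimum separating
set, which leaves two nonempty parts with no arcs from the first to the second. -/
theorem exists_parts_of_vertexConnectivity_eq [Fintype V] [DecidableEq V] (G : Digraph V) {k : ℕ}
    (hk : 1 ≤ k) (hn : k + 2 ≤ Fintype.card V) (hconn : G.vertexConnectivity = k) :
    ∃ B C : Finset V, B.Nonempty ∧ C.Nonempty ∧ Disjoint B C ∧
      B.card + C.card + k = Fintype.card V ∧ ∀ a ∈ B, ∀ b ∈ C, ¬ G.Adj a b := by
  classical
  -- The infimum of the empty set is 0, so `k ≥ 1` ensures that it is attained.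
  have hmem : G.vertexConnectivity ∈ {c : ℕ | ∃ S : Finset V, S.card = c ∧
    (¬ (G.inducedOn {a | a ∉ S}).StronglyConnected ∨ Sᶜ.card ≤ 1)} :=
    Nat.sInf_mem (Nat.nonempty_of_pos_sInf (by
      change 0 < G.vertexConnectivity
      omega))
  rw [hconn] at hmem
  obtain ⟨S, hS, h⟩ := hmem
  have hSc := Finset.card_add_card_compl S
  have h : ¬ (G.inducedOn {a | a ∉ S}).StronglyConnected := h.resolve_right (by omega)
  unfold StronglyConnected at h
  push Not at h
  obtain ⟨a, b, hab⟩ := h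
  -- `B` is what `a` reaches outside `S`, and `C` the rest; an arc from `B` to `C` would extend a
  -- walk.
  let R : V → Prop := fun v => ∃ hv : v ∉ S, ∃ l, (G.inducedOn {a | a ∉ S}).HasWalk l a ⟨v, hv⟩
  refine ⟨Finset.univ.filter R, Finset.univ.filter fun v => v ∉ S ∧ ¬ R v,
    ⟨a, ?_⟩, ⟨b, ?_⟩, ?_, ?_, ?_⟩
  · simp only [Finset.mem_filter, Finset.mem_univ, true_and]
    exact ⟨a.2, 0, .nil a⟩
  · simp only [Finset.mem_filter, Finset.mem_univ, true_and]
    refine ⟨b.2, ?_⟩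
    rintro ⟨_, l, hl⟩
    exact hab l hl
  · rw [Finset.disjoint_left]
    intro v h1 h2
    simp only [Finset.mem_filter, Finset.mem_univ, true_and] at h1 h2
    exact h2.2 h1
  · have hun : Finset.univ.filter R ∪ (Finset.univ.filter fun v => v ∉ S ∧ ¬ R v) = Sᶜ := by
      ext v
      simp only [Finset.mem_union, Finset.mem_filter, Finset.mem_univ, true_and,
        Finset.mem_compl]
      constructor
      · rintro (h | h)
        · exact h.1
        · exact h.1
      · intro h
        by_cases hR : R v
        · exact .inl hR
        · exact .inr ⟨h, hR⟩
    rw [← Finset.card_union_of_disjoint, hun]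
    · omega
    · rw [Finset.disjoint_left]
      intro v h1 h2
      simp only [Finset.mem_filter, Finset.mem_univ, true_and] at h1 h2
      exact h2.2 h1
  · intro v hv w hw hadj
    simp only [Finset.mem_filter, Finset.mem_univ, true_and] at hv hw
    obtain ⟨hvS, l, hl⟩ := hv
    have hadj' : (G.inducedOn {a | a ∉ S}).Adj ⟨v, hvS⟩ ⟨w, hw.1⟩ := hadj
    exact hw.2 ⟨hw.1, l + 1, hl.concat hadj'⟩

/-- Membership in `B` and `C` decides every arc, so any bijection matching the three parts is an
isomorphism. -/
theorem CompleteExcept.isomorphic_K [Fintype V] [DecidableEq V] {G : Digraph V} {B C : Finset V}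
    (h : G.CompleteExcept B C) (hBC : Disjoint B C) {n k m : ℕ} (hn : Fintype.card V = n)
    (hB : B.card = n - k - m) (hC : C.card = m) (hcard : B.card + C.card + k = n) :
    G.Isomorphic (K n k m) := by
  classical
  have hA : (B ∪ C)ᶜ.card = k := by
    have := Finset.card_add_card_compl (B ∪ C)
    rw [Finset.card_union_of_disjoint hBC] at this
    omega
  let eA := (Finset.equivFinOfCardEq hA).symm
  let eB := (Finset.equivFinOfCardEq hB).symm
  let eC := (Finset.equivFinOfCardEq hC).symm
  let f : KVertex n k m → V :=
    Sum.elim (fun i => (eA i : V)) (Sum.elim (fun i => (eB i : V)) fun i => (eC i : V))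
  have hAB : ∀ i, (eA i : V) ∉ B := fun i hi => by
    have := (eA i).2
    simp only [Finset.mem_compl, Finset.mem_union, not_or] at this
    exact this.1 hi
  have hAC : ∀ i, (eA i : V) ∉ C := fun i hi => by
    have := (eA i).2
    simp only [Finset.mem_compl, Finset.mem_union, not_or] at this
    exact this.2 hi
  have hB' : ∀ i, (eB i : V) ∈ B := fun i => (eB i).2
  have hC' : ∀ i, (eC i : V) ∈ C := fun i => (eC i).2
  have hBC' : ∀ i, (eB i : V) ∉ C := fun i hi => Finset.disjoint_left.1 hBC (hB' i) hi
  have hCB' : ∀ i, (eC i : V) ∉ B := fun i hi => Finset.disjoint_left.1 hBC hi (hC' i)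
  have hinj : Function.Injective f := by
    refine Function.Injective.sumElim (Subtype.val_injective.comp eA.injective)
      (Function.Injective.sumElim (Subtype.val_injective.comp eB.injective)
        (Subtype.val_injective.comp eC.injective) ?_) ?_
    · intro i j hij
      exact hBC' i (hij ▸ hC' j)
    · rintro i (j | j) hij
      · exact hAB i (by rw [show (eA i : V) = eB j from hij]; exact hB' j)
      · exact hAC i (by rw [show (eA i : V) = eC j from hij]; exact hC' j)
  have hbij : Function.Bijective f := by
    rw [Fintype.bijective_iff_injective_and_card]
    refine ⟨hinj, ?_⟩
    simp only [KVertex, Fintype.card_sum, Fintype.card_fin]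
    omega
  refine ⟨(RelIso.symm ⟨Equiv.ofBijective f hbij, ?_⟩)⟩
  intro a b
  rw [Equiv.ofBijective_apply, Equiv.ofBijective_apply, h, hinj.ne_iff]
  rcases a with a | a | a <;> rcases b with b | b | b <;>
    simp [f, hAB, hAC, hB', hC', hBC', hCB', K, join, disjUnion, looplessComplete]

theorem Isomorphic.exists_completeExcept {V : Type*} [Fintype V] [DecidableEq V] {G : Digraph V}
    {n k m : ℕ} (h : G.Isomorphic (K n k m)) :
    ∃ B C : Finset V, G.CompleteExcept B C ∧ Disjoint B C ∧ B.card = n - k - m ∧ C.card = m := by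
  obtain ⟨e⟩ := h
  let g := e.toEquiv.symm
  let B : Finset V := Finset.univ.map ⟨fun i : Fin (n - k - m) => g (.inr (.inl i)),
    g.injective.comp (Sum.inr_injective.comp Sum.inl_injective)⟩
  let C : Finset V := Finset.univ.map ⟨fun i : Fin m => g (.inr (.inr i)),
    g.injective.comp (Sum.inr_injective.comp Sum.inr_injective)⟩
  have hB : ∀ x, g x ∈ B ↔ ∃ i, x = .inr (.inl i) := fun x => by
    simp [B, eq_comm]
  have hC : ∀ x, g x ∈ C ↔ ∃ i, x = .inr (.inr i) := fun x => by
    simp [C, eq_comm]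
  refine ⟨B, C, ?_, ?_, by simp [B], by simp [C]⟩
  · intro a b
    obtain ⟨x, rfl⟩ := g.surjective a
    obtain ⟨y, rfl⟩ := g.surjective b
    have : G.Adj (g x) (g y) ↔ (K n k m).Adj x y := e.symm.map_rel_iff
    rw [this, hB, hC, g.injective.ne_iff]
    rcases x with a | a | a <;> rcases y with b | b | b <;>
      simp [K, join, disjUnion, looplessComplete]
  · rw [Finset.disjoint_left]
    intro a h1 h2
    obtain ⟨x, rfl⟩ := g.surjective a
    obtain ⟨i, rfl⟩ := (hB _).1 h1
    obtain ⟨j, hj⟩ := (hC _).1 h2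
    simp at hj

/-! ### The test vector and the extremal value. -/

variable [Fintype V] [DecidableEq V]

/-- Expanding the transmission makes each row a single sum over distances, with positive weights
when `x > 0` and `0 ≤ α < 1`. -/
theorem genDistMatrix_mulVec (α : ℝ) (G : Digraph V) (x : V → ℝ) (i : V) :
    (genDistMatrix α G).mulVec x i = ∑ j, (G.dist i j : ℝ) * (α * x i + (1 - α) * x j) := by
  rw [genDistMatrix, Matrix.add_mulVec, Matrix.smul_mulVec, Matrix.smul_mulVec]
  simp only [Pi.add_apply, Pi.smul_apply, Matrix.mulVec_diagonal, smul_eq_mul, transmission,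
    Nat.cast_sum]
  simp only [distMatrix, Matrix.mulVec, dotProduct, Matrix.of_apply, mul_add,
    Finset.sum_add_distrib, Finset.mul_sum, Finset.sum_mul]
  congr 1 <;> exact Finset.sum_congr rfl fun j _ => by ring

theorem genDistMatrix_nonneg {α : ℝ} (h0 : 0 ≤ α) (h1 : α < 1) (G : Digraph V) (i j : V) :
    0 ≤ genDistMatrix α G i j := by
  simp only [genDistMatrix, Matrix.add_apply, Matrix.smul_apply, smul_eq_mul, distMatrix,
    Matrix.of_apply, Matrix.diagonal_apply]
  have : 0 ≤ 1 - α := by linarith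
  split_ifs <;> positivity

theorem StronglyConnected.genDistMatrix_pos {α : ℝ} (h1 : α < 1) {G : Digraph V}
    (hG : G.StronglyConnected) {i j : V} (hij : i ≠ j) : 0 < genDistMatrix α G i j := by
  simp only [genDistMatrix, Matrix.add_apply, Matrix.smul_apply, smul_eq_mul, distMatrix,
    Matrix.of_apply, Matrix.diagonal_apply, hij, if_false, mul_zero, zero_add]
  have h2 : 0 < 1 - α := by linarith
  have h3 : (0 : ℝ) < G.dist i j := by exact_mod_cast hG.one_le_dist hij
  positivity

/-- The vector with value `w` on `B` and `u` elsewhere. -/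
def twoValued (B : Finset V) (w u : ℝ) (i : V) : ℝ := if i ∈ B then w else u

/-- As a matrix, `cutDist` is all ones, minus the identity, plus the indicator of `B × C`; these
give the three summands. -/
theorem sum_cutDist_mul {B C : Finset V} (hBC : Disjoint B C) (α w u : ℝ) (i : V) :
    ∑ j, (cutDist B C i j : ℝ) * (α * twoValued B w u i + (1 - α) * twoValued B w u j) =
      (α * Fintype.card V - 1) * twoValued B w u i
        + (1 - α) * (B.card * w + (Fintype.card V - B.card) * u)
        + if i ∈ B then C.card * (α * w + (1 - α) * u) else 0 := by
  have hsum : ∑ j, twoValued B w u j = B.card * w + (Fintype.card V - B.card) * u := by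
    have : ∀ j, twoValued B w u j = u + if j ∈ B then w - u else 0 := fun j => by
      unfold twoValued; split_ifs <;> ring
    simp only [this, Finset.sum_add_distrib, Finset.sum_const, Finset.sum_ite_mem,
      Finset.univ_inter, Finset.card_univ, nsmul_eq_mul]
    ring
  have hsplit : ∀ j, (cutDist B C i j : ℝ) *
        (α * twoValued B w u i + (1 - α) * twoValued B w u j) =
      (α * twoValued B w u i + (1 - α) * twoValued B w u j)
        - (if i = j then twoValued B w u i else 0)
        + if j ∈ C then (if i ∈ B then α * w + (1 - α) * u else 0) else 0 := fun j => by
    unfold cutDist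
    by_cases hj : j ∈ C
    · have hjB : j ∉ B := fun h => Finset.disjoint_left.1 hBC h hj
      by_cases hi : i ∈ B
      · have hij : i ≠ j := by rintro rfl; exact hjB hi
        simp [hi, hj, hij, hjB, twoValued]; ring
      · by_cases hij : i = j
        · subst hij; simp [hi]; ring
        · simp [hi, hij]
    · by_cases hij : i = j
      · subst hij; simp [hj]; ring
      · simp [hj, hij]
  simp only [hsplit, Finset.sum_add_distrib, Finset.sum_sub_distrib, ← Finset.mul_sum, hsum,
    Finset.sum_const, Finset.sum_ite_mem, Finset.univ_inter, Finset.card_univ, nsmul_eq_mul,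
    Finset.sum_ite_eq, Finset.mem_univ, if_true]
  split_ifs <;> ring

/-- The `D_α` spectral radius of `K(n, k, 1)`. -/
noncomputable def muMin (n k α : ℝ) : ℝ :=
  (n - 2 + α + α * n + √((1 - α) ^ 2 * n ^ 2 + (2 * α ^ 2 - 6 * α + 4) * n
    + (α ^ 2 + 4 * α - 4) - 4 * (1 - α) * k)) / 2

/-- The shift by `α n - 1` absorbs the diagonal part common to all rows. The quadratic for `y` is
the eigenvalue condition on the `B` rows when `|C| = 1`. -/
theorem exists_muMin_eq {n k α : ℝ} (h1 : α < 1) (hk : k + 1 < n) :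
    ∃ y, muMin n k α = y + α * n - 1 ∧ (1 - α) * n < y ∧
      y ^ 2 = (1 - α) * n * y + α * y + (1 - α) ^ 2 * n - (1 - α) * k - (1 - α) := by
  have hβ : 0 < 1 - α := by linarith
  have hdisc : (1 - α) ^ 2 * n ^ 2 + (2 * α ^ 2 - 6 * α + 4) * n
      + (α ^ 2 + 4 * α - 4) - 4 * (1 - α) * k
      = ((1 - α) * n - α) ^ 2 + 4 * ((1 - α) * (n - (k + 1))) := by ring
  have hpos : 0 < (1 - α) * (n - (k + 1)) := mul_pos hβ (by linarith)
  set s := √((1 - α) ^ 2 * n ^ 2 + (2 * α ^ 2 - 6 * α + 4) * n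
    + (α ^ 2 + 4 * α - 4) - 4 * (1 - α) * k) with hs
  have hs2 : s ^ 2 = ((1 - α) * n - α) ^ 2 + 4 * ((1 - α) * (n - (k + 1))) := by
    rw [hs, Real.sq_sqrt (by rw [hdisc]; positivity), hdisc]
  have hs3 : (1 - α) * n - α < s := by
    have := Real.sqrt_nonneg ((1 - α) ^ 2 * n ^ 2 + (2 * α ^ 2 - 6 * α + 4) * n
      + (α ^ 2 + 4 * α - 4) - 4 * (1 - α) * k)
    exact lt_of_pow_lt_pow_left₀ 2 this (by rw [hs2]; linarith)
  refine ⟨((1 - α) * n + α + s) / 2, ?_, by linarith, ?_⟩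
  · rw [muMin, ← hs]; ring
  · linear_combination hs2 / 4

theorem muMin_nonneg {n k α : ℝ} (h1 : α < 1) (hn : 2 ≤ n) (hk : k + 1 < n) :
    0 ≤ muMin n k α := by
  obtain ⟨y, hr, hy, -⟩ := exists_muMin_eq h1 hk
  rw [hr]
  linarith

/-- If `G` has no arcs from `B` to `C`, then `μ_α(G)` is at least `muMin`, and equality holds
exactly if all distances are as small as possible and `B`, `C` are of extremal sizes. -/
theorem StronglyConnected.muMin_le_mu {G : Digraph V} (hG : G.StronglyConnected) {n k : ℕ}
    {B C : Finset V} (hBne : B.Nonempty) (hCne : C.Nonempty) (hBC : Disjoint B C)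
    (hno : ∀ a ∈ B, ∀ b ∈ C, ¬ G.Adj a b) (hn : Fintype.card V = n)
    (hcard : B.card + C.card + k = n) (hk : 1 ≤ k) {α : ℝ} (h0 : 0 ≤ α) (h1 : α < 1) :
    muMin n k α ≤ G.mu α ∧ (G.mu α = muMin n k α ↔
      (∀ a b, G.dist a b = cutDist B C a b) ∧ (C.card = 1 ∨ α = 0 ∧ B.card = 1)) := by
  have hBpos := hBne.card_pos
  have hCpos := hCne.card_pos
  obtain ⟨i₀, hi₀⟩ := hBne
  have : Nonempty V := ⟨i₀⟩
  have hβ : 0 < 1 - α := by linarith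
  have hb : (1 : ℝ) ≤ B.card := by exact_mod_cast hBpos
  have hm : (1 : ℝ) ≤ C.card := by exact_mod_cast hCpos
  have hk' : (1 : ℝ) ≤ k := by exact_mod_cast hk
  have hc : (B.card : ℝ) + C.card + k = n := by exact_mod_cast hcard
  have hkn : (k : ℝ) + 1 < n := by linarith
  have hr0 := muMin_nonneg h1 (by linarith) hkn
  obtain ⟨y, hr, hy, hy2⟩ := exists_muMin_eq h1 hkn
  set r := muMin n k α
  -- `u` and `w` solve the rows outside `B` exactly, so the whole discrepancy falls on `B`.
  set u : ℝ := (1 - α) * B.card with hu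
  set w : ℝ := y - (1 - α) * (n - B.card) with hw
  set x := twoValued B w u with hx
  -- The excess in a row of `B`, after reduction by the quadratic for `y`.
  set gap : ℝ := (C.card - 1) * (α * (y - (1 - α) * n) + (1 - α) * (B.card - 1)) with hgap
  have hu0 : 0 < u := by positivity
  have hw0 : 0 < w := by
    have : 0 < (1 - α) * (B.card : ℝ) := hu0
    rw [hw]; linarith
  have hx0 : ∀ i, 0 < x i := fun i => by
    rw [hx]; unfold twoValued; split_ifs <;> assumption
  have hgap0 : 0 ≤ gap :=
    mul_nonneg (by linarith) (add_nonneg (mul_nonneg h0 (by linarith))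
      (mul_nonneg hβ.le (by linarith)))
  have hE : ∀ i, ∑ j, (cutDist B C i j : ℝ) * (α * x i + (1 - α) * x j) =
      r * x i + if i ∈ B then gap else 0 := fun i => by
    rw [hx, sum_cutDist_mul hBC, hn, hr]
    unfold twoValued
    by_cases hi : i ∈ B
    · simp only [hi, if_true, hw, hu, hgap]
      rw [← hc] at hy2 ⊢
      linear_combination (-1 : ℝ) * hy2
    · simp only [hi, if_false, hw, hu]
      ring
  have hle := hG.cutDist_le_dist hBC hno
  have hwt : ∀ i j, 0 < α * x i + (1 - α) * x j := fun i j =>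
    add_pos_of_nonneg_of_pos (mul_nonneg h0 (hx0 i).le) (mul_pos hβ (hx0 j))
  have hterm : ∀ i j, (cutDist B C i j : ℝ) * (α * x i + (1 - α) * x j) ≤
      (G.dist i j : ℝ) * (α * x i + (1 - α) * x j) := fun i j =>
    mul_le_mul_of_nonneg_right (by exact_mod_cast hle i j) (hwt i j).le
  have hrow : ∀ i, r * x i + (if i ∈ B then gap else 0) ≤ (genDistMatrix α G).mulVec x i :=
    fun i => by
      rw [genDistMatrix_mulVec, ← hE]
      exact Finset.sum_le_sum fun j _ => hterm i j
  have hrow' : ∀ i, r * x i ≤ (genDistMatrix α G).mulVec x i := fun i =>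
    (le_add_of_nonneg_right (by split_ifs <;> simp [hgap0])).trans (hrow i)
  have hnn := genDistMatrix_nonneg h0 h1 G
  have hgapiff : gap = 0 ↔ (C.card = 1 ∨ α = 0 ∧ B.card = 1) := by
    rw [hgap, mul_eq_zero, sub_eq_zero, Nat.cast_eq_one, add_eq_zero_iff_of_nonneg
      (mul_nonneg h0 (by linarith)) (mul_nonneg hβ.le (by linarith)), mul_eq_zero, mul_eq_zero,
      or_iff_left (by linarith : y - (1 - α) * n ≠ 0), or_iff_right hβ.ne', sub_eq_zero,
      Nat.cast_eq_one]
  refine ⟨le_spectralRadius_of_smul_le_mulVec _ hnn x hx0 r hr0 hrow', ?_, ?_⟩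
  · intro heq
    have hall : ∀ i, (genDistMatrix α G).mulVec x i = r * x i := by
      intro i
      by_contra hne
      exact heq.not_gt (lt_spectralRadius_of_smul_lt_mulVec _ hnn
        (fun i j hij => hG.genDistMatrix_pos h1 hij) x hx0 r hr0 hrow' i
        (lt_of_le_of_ne (hrow' i) (Ne.symm hne)))
    have hg : gap = 0 := by
      have := hrow i₀
      rw [hall, if_pos hi₀] at this
      linarith
    refine ⟨fun a b => ?_, hgapiff.1 hg⟩
    -- Equal row sums with termwise inequality force equal terms; the positive weights then cancel.
    have hs := hall a
    have hE' := hE a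
    rw [hg, ite_self, add_zero, ← hs, genDistMatrix_mulVec,
      Finset.sum_eq_sum_iff_of_le fun j _ => hterm a j] at hE'
    exact_mod_cast (mul_right_cancel₀ (hwt a b).ne' (hE' b (Finset.mem_univ _))).symm
  · rintro ⟨hdist, hg⟩
    refine spectralRadius_eq_of_mulVec_eq _ hnn x hx0 r hr0 fun i => ?_
    rw [genDistMatrix_mulVec]
    simp only [hdist]
    rw [hE, hgapiff.2 hg, ite_self, add_zero]

/-- Distances here equal `cutDist`, so the equality criterion of `muMin_le_mu` applies; `m = n - k -
1` means `|B| = 1`. -/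
theorem Isomorphic.mu_eq_muMin {G : Digraph V} {n k m : ℕ} (hk : 1 ≤ k) (hm : 1 ≤ m)
    (hmn : m + k + 1 ≤ n) (hn : Fintype.card V = n) (h : G.Isomorphic (K n k m)) {α : ℝ}
    (h0 : 0 ≤ α) (h1 : α < 1) (hext : m = 1 ∨ α = 0 ∧ m = n - k - 1) :
    G.mu α = muMin n k α := by
  obtain ⟨B, C, hBC, hdisj, hB, hC⟩ := h.exists_completeExcept
  have hA : ∃ v, v ∉ B ∧ v ∉ C := by
    have : (B ∪ C).card < Fintype.card V := by
      rw [Finset.card_union_of_disjoint hdisj]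
      omega
    obtain ⟨v, hv⟩ := Finset.exists_mem_notMem_of_card_lt_card (t := Finset.univ) this
    exact ⟨v, by simpa using hv⟩
  refine ((hBC.stronglyConnected hdisj hA).muMin_le_mu (Finset.card_pos.1 (by omega))
    (Finset.card_pos.1 (by omega)) hdisj
    (fun a ha b hb hadj => ((hBC a b).1 hadj).2 ⟨ha, hb⟩) hn (by omega) hk h0 h1).2.2
    ⟨hBC.dist_eq hdisj hA, ?_⟩
  rcases hext with h | ⟨hα, h⟩
  · left; omega
  · right; exact ⟨hα, by omega⟩

theorem mu_K_eq_muMin {n k m : ℕ} (hk : 1 ≤ k) (hm : 1 ≤ m)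
    (hmn : m + k + 1 ≤ n) {α : ℝ}
    (h0 : 0 ≤ α) (h1 : α < 1) (hext : m = 1 ∨ α = 0 ∧ m = n - k - 1) :
    (K n k m).mu α = muMin n k α := by
  refine Isomorphic.mu_eq_muMin hk hm hmn ?_ ⟨RelIso.refl _⟩ h0 h1 hext
  simp only [KVertex, Fintype.card_sum, Fintype.card_fin]
  omega

/-- Among strongly connected digraphs of order `n` and vertex connectivity `k`, the value `muMin`
is the least `D_α` spectral radius. -/
theorem muMin_le_mu_and_eq_iff {G : Digraph V} {n k : ℕ}
    (hk : 1 ≤ k) (hkn : k + 2 ≤ n) (hloopless : ∀ a : V, ¬ G.Adj a a)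
    (hcard : Fintype.card V = n) (hG : G.StronglyConnected) (hconn : G.vertexConnectivity = k)
    {α : ℝ} (h0 : 0 ≤ α) (h1 : α < 1) :
    muMin n k α ≤ G.mu α ∧ (G.mu α = muMin n k α ↔
      α = 0 ∧ G.Isomorphic (K n k (n - k - 1)) ∨ G.Isomorphic (K n k 1)) := by
  obtain ⟨B, C, hB, hC, hBC, hsum, hno⟩ :=
    G.exists_parts_of_vertexConnectivity_eq hk (by omega) hconn
  rw [hcard] at hsum
  have hBpos := hB.card_pos
  have hCpos := hC.card_pos
  have key := hG.muMin_le_mu hB hC hBC hno hcard hsum hk h0 h1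
  refine ⟨key.1, fun h => ?_, ?_⟩
  · obtain ⟨hdist, hext⟩ := key.2.1 h
    have hce := hG.completeExcept_of_dist_eq hloopless hno hdist
    rcases hext with hm | ⟨hα, hb⟩
    · exact .inr (hce.isomorphic_K hBC hcard (by omega) hm hsum)
    · exact .inl ⟨hα, hce.isomorphic_K hBC hcard (by omega) (by omega) hsum⟩
  · rintro (⟨hα, h⟩ | h)
    · exact h.mu_eq_muMin hk (by omega) (by omega) hcard h0 h1 (.inr ⟨hα, rfl⟩)
    · exact h.mu_eq_muMin hk le_rfl (by omega) hcard h0 h1 (.inl rfl)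

theorem muMin_zero (n k : ℝ) :
    muMin n k 0 = (n - 2 + √(n ^ 2 + 4 * n - 4 * k - 4)) / 2 := by
  unfold muMin
  congr 2
  · ring
  · congr 1; ring

end Digraph

theorem theorem4p6 {V : Type*} [Fintype V] [DecidableEq V] (G : Digraph V) (n k : ℕ)
    (hk : 1 ≤ k) (hn : 2 * k + 2 ≤ n)
    (hloopless : ∀ a : V, ¬ G.Adj a a)
    (hcard : Fintype.card V = n)
    (hG : G.StronglyConnected)
    (hconn : G.vertexConnectivity = k) :
    (((n : ℝ) - 2 + √((n : ℝ) ^ 2 + 4 * n - 4 * k - 4)) / 2 ≤ G.mu 0 ∧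
      (G.mu 0 = ((n : ℝ) - 2 + √((n : ℝ) ^ 2 + 4 * n - 4 * k - 4)) / 2 ↔
        G.Isomorphic (Digraph.K n k (n - k - 1)) ∨ G.Isomorphic (Digraph.K n k 1)) ∧
      (Digraph.K n k 1).mu 0 = ((n : ℝ) - 2 + √((n : ℝ) ^ 2 + 4 * n - 4 * k - 4)) / 2 ∧
      (Digraph.K n k (n - k - 1)).mu 0 =
        ((n : ℝ) - 2 + √((n : ℝ) ^ 2 + 4 * n - 4 * k - 4)) / 2) ∧
    (∀ α : ℝ, 0 < α → α < 1 →
      (Digraph.K n k 1).mu α =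
        ((n : ℝ) - 2 + α + α * n + √((1 - α) ^ 2 * (n : ℝ) ^ 2 + (2 * α ^ 2 - 6 * α + 4) * n
          + (α ^ 2 + 4 * α - 4) - 4 * (1 - α) * k)) / 2 ∧
      ((n : ℝ) - 2 + α + α * n + √((1 - α) ^ 2 * (n : ℝ) ^ 2 + (2 * α ^ 2 - 6 * α + 4) * n
          + (α ^ 2 + 4 * α - 4) - 4 * (1 - α) * k)) / 2 ≤ G.mu α ∧
      (G.mu α =
        ((n : ℝ) - 2 + α + α * n + √((1 - α) ^ 2 * (n : ℝ) ^ 2 + (2 * α ^ 2 - 6 * α + 4) * n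
          + (α ^ 2 + 4 * α - 4) - 4 * (1 - α) * k)) / 2 ↔
        G.Isomorphic (Digraph.K n k 1))) := by 
  rw [← Digraph.muMin_zero]
  refine ⟨?_, fun α h0 h1 => ?_⟩
  · have h := Digraph.muMin_le_mu_and_eq_iff hk (by omega) hloopless hcard hG hconn
      le_rfl zero_lt_one
    simp only [true_and] at h
    exact ⟨h.1, h.2, Digraph.mu_K_eq_muMin hk le_rfl (by omega) le_rfl zero_lt_one (.inl rfl),
      Digraph.mu_K_eq_muMin hk (by omega) (by omega) le_rfl zero_lt_one (.inr ⟨rfl, rfl⟩)⟩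
  · have h := Digraph.muMin_le_mu_and_eq_iff hk (by omega) hloopless hcard hG hconn h0.le h1
    simp only [h0.ne', false_and, false_or] at h
    exact ⟨Digraph.mu_K_eq_muMin hk le_rfl (by omega) h0.le h1 (.inl rfl), h⟩
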